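/- Let $$\bar r(t)=\frac49-\frac{\cos t}{693}-\frac{\sin t}{51}-\frac{\cos 2t}{653}-\frac{\sin 2t}{45}-\frac{\cos 3t}{780},$$ and consider the differential equation $$r'=X(r,t):=\frac{1}{10}\,r-\frac{1}{10}\cos(t)\,r^2-\cos^2(t)\,r^3,\qquad t\in\mathbb R .$$ This equation has a $2\pi$-periodic solution $r^*:\mathbb R\to\mathbb R$ such that $\|\bar r-r^*\|_\infty=\sup_{t\in\mathbb R}|\bar r(t)-r^*(t)|\le 0.042$. The solution $r^*$ is hyperbolic, that is, $\int_0^{2\pi}\frac{\partial X}{\partial r}(r^*(t),t)\,dt\ne0$ and the return map $r(0)\mapsto r(2\pi)$, which is defined near $r^*(0)$, is differentiable at $r^*(0)$ with derivative of absolute value different from $1$. It is also stable: it is Lyapunov stable, and all solutions starting sufficiently close to it converge to it as $t\to\infty$. Moreover, $r^*$ is the only periodic solution (of any period) of the equation that is contained in this strip, i.e. the only periodic solution $\rho:\mathbb R\to\mathbb R$ with $|\bar r(t)-\rho(t)|\le 0.042$ for all $t\in\mathbb R$. -/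

import Mathlib

open Set Filter Topology

noncomputable section

/-- `x` solves the scalar equation `x' = X(x, t)` on the set `s` of times
(one-sided derivatives at the end points when `s` is an interval). -/
def IsSolutionOn (X : ℝ → ℝ → ℝ) (s : Set ℝ) (x : ℝ → ℝ) : Prop :=
  ∀ t ∈ s, HasDerivWithinAt x (X (x t) t) s t

/-- `x` is a periodic solution of `x' = X(x, t)`, of period `T > 0`, defined for all times. -/
def IsPeriodicSolution (X : ℝ → ℝ → ℝ) (T : ℝ) (x : ℝ → ℝ) : Prop :=
  0 < T ∧ Function.Periodic x T ∧ IsSolutionOn X univ x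

/-- `P` is the time-`T` return (Poincaré) map of `x' = X(x, t)` in a neighbourhood of `ξ₀`:
for all `ξ` near `ξ₀` a solution on `[0, T]` starting at `ξ` exists, and every such solution
ends at `P ξ`. -/
def IsReturnMapNear (X : ℝ → ℝ → ℝ) (T ξ₀ : ℝ) (P : ℝ → ℝ) : Prop :=
  ∀ᶠ ξ in 𝓝 ξ₀,
    (∃ x : ℝ → ℝ, IsSolutionOn X (Icc 0 T) x ∧ x 0 = ξ) ∧
    ∀ x : ℝ → ℝ, IsSolutionOn X (Icc 0 T) x → x 0 = ξ → x T = P ξ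

/-- Hyperbolicity of the periodic solution `r` of the `T`-periodic equation `x' = X(x, t)`:
the return map is defined near `r 0` and differentiable there, with derivative (the
characteristic multiplier of `r`) off the unit circle. -/
def IsHyperbolic (X : ℝ → ℝ → ℝ) (T : ℝ) (r : ℝ → ℝ) : Prop :=
  ∃ (P : ℝ → ℝ) (m : ℝ), IsReturnMapNear X T (r 0) P ∧ HasDerivAt P m (r 0) ∧ |m| ≠ 1

/-- The integral of `∂X/∂x` along `r` over one period does not vanish. -/
def IsNoncritical (X : ℝ → ℝ → ℝ) (T : ℝ) (r : ℝ → ℝ) : Prop :=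
  ∫ t in (0 : ℝ)..T, deriv (fun x => X x t) (r t) ≠ 0

/-- Lyapunov stability of the solution `r`: from every initial time `t₀`, every initial value
close enough to `r t₀` is continued by a solution to all of `[t₀, ∞)`, and every such solution
stays close to `r`. -/
def IsLyapunovStable (X : ℝ → ℝ → ℝ) (r : ℝ → ℝ) : Prop :=
  ∀ t₀ : ℝ, ∀ ε > 0, ∃ δ > 0, ∀ ξ : ℝ, |ξ - r t₀| < δ →
    (∃ x : ℝ → ℝ, IsSolutionOn X (Ici t₀) x ∧ x t₀ = ξ) ∧
    ∀ x : ℝ → ℝ, IsSolutionOn X (Ici t₀) x → x t₀ = ξ → ∀ t ≥ t₀, |x t - r t| < ε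

/-- (Asymptotic) stability of the solution `r`: it is Lyapunov stable, and the solutions that
start close enough to it converge to it as `t → ∞`. -/
def IsAsymptoticallyStable (X : ℝ → ℝ → ℝ) (r : ℝ → ℝ) : Prop :=
  IsLyapunovStable X r ∧
  ∀ t₀ : ℝ, ∃ δ > 0, ∀ x : ℝ → ℝ, IsSolutionOn X (Ici t₀) x → |x t₀ - r t₀| < δ →
    Tendsto (fun t => x t - r t) atTop (𝓝 0)

/-- Right-hand side of `r' = r/10 - cos(t) r²/10 - cos²(t) r³`. -/
def rigidCubic (r t : ℝ) : ℝ :=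
  r / 10 - Real.cos t * r ^ 2 / 10 - Real.cos t ^ 2 * r ^ 3

/-- The explicit trigonometric polynomial approximating the periodic solution. -/
def rBar (t : ℝ) : ℝ :=
  4 / 9 - Real.cos t / 693 - Real.sin t / 51 - Real.cos (2 * t) / 653
    - Real.sin (2 * t) / 45 - Real.cos (3 * t) / 780

/-- The closed strip of half-width `c` around the graph of `f`, i.e. `‖f - x‖_∞ ≤ c`. -/
def InStrip (f : ℝ → ℝ) (c : ℝ) (x : ℝ → ℝ) : Prop :=
  ∀ t : ℝ, |f t - x t| ≤ c

end

/-!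
The equation contracts, on average over a period, in the band `7 / 20 ≤ r ≤ 27 / 50`, which contains
the strip around `rBar`. Indeed the difference of two solutions `x`, `y` satisfies the linear
equation `d' = A d` with the polynomial coefficient
`A = 1 / 10 - cos t (x + y) / 10 - cos² t (x² + x y + y²)` (`rigidCubicSlope`), and as long as
`x`, `y` are in the band, `A ≤ bandRate t`, a trigonometric polynomial with mean `-69 / 1000`
(`rigidCubicSlope_le_bandRate`).

*Existence.* In the variable `u = 1 / r` the equation becomes
`u u' + u² / 10 - u cos t / 10 - cos² t = 0`. Two explicit trigonometric polynomials of degree two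
make the left-hand side nonnegative, respectively nonpositive, so their reciprocals are a sub- and a
supersolution, both within the strip; all inequalities involved compare a constant term with the sum
of the amplitudes of the other harmonics. Hence the time-`2π` map preserves the interval between the
barriers and has a fixed point there (`exists_periodic_isClippedSolution`). To have global solutions
at hand, this is carried out for the equation clipped outside the band, which is bounded and
globally Lipschitz.

*Stability.* For the periodic solution `r` and small `δ`, the curves `r ± δ exp (∫ bandRate)` are
barriers as well, so nearby solutions converge to `r` (`IsClippedSolution.abs_sub_le_exp`).

*Hyperbolicity.* The difference quotients of the return map at `r 0` are `exp (∫ A)`, with limit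
`exp (∫ ∂X/∂r)` along `r`, and the integral is negative (`IsClippedSolution.isHyperbolic`).

*Uniqueness.* Two solutions that are in the band for all times are at bounded distance in the remote
past, so by contraction they coincide now (`le_of_solutions_in_band`); periodicity plays no role.
-/

/-! ### Comparison and global existence for scalar equations -/

theorem hasDerivAt_sq_max_zero (x : ℝ) :
    HasDerivAt (fun y : ℝ => max y 0 ^ 2) (2 * max x 0) x := by
  rcases lt_trichotomy x 0 with hx | rfl | hx
  · have h : (fun y : ℝ => max y 0 ^ 2) =ᶠ[𝓝 x] fun _ => 0 := by
      filter_upwards [Iio_mem_nhds hx] with y hy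
      simp [max_eq_right (le_of_lt (mem_Iio.1 hy))]
    simpa [max_eq_right hx.le] using (hasDerivAt_const x (0 : ℝ)).congr_of_eventuallyEq h
  · rw [hasDerivAt_iff_tendsto_slope]
    have h : Tendsto (fun y : ℝ => max y 0) (𝓝[≠] 0) (𝓝 (2 * max (0 : ℝ) 0)) := by
      have : ContinuousAt (fun y : ℝ => max y 0) 0 := by fun_prop
      simpa using this.tendsto.mono_left nhdsWithin_le_nhds
    refine h.congr' ?_
    filter_upwards [self_mem_nhdsWithin] with y hy
    have hy : y ≠ 0 := hy
    rcases le_total y 0 with h0 | h0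
    · simp [slope_def_field, max_eq_right h0]
    · simp only [slope_def_field, max_eq_left h0, max_self]
      field_simp
      ring
  · have h : (fun y : ℝ => max y 0 ^ 2) =ᶠ[𝓝 x] fun y => y ^ 2 := by
      filter_upwards [Ioi_mem_nhds hx] with y hy
      simp [max_eq_left (le_of_lt (mem_Ioi.1 hy))]
    simpa [max_eq_left hx.le] using (hasDerivAt_pow 2 x).congr_of_eventuallyEq h

/-- **Linear comparison principle.** It suffices that `u' ≤ g u` where `u` is positive. The
positive part of `u e^{-G}` need not be differentiable, but its square is, and it decreases. -/
theorem le_max_mul_exp_of_deriv_le {u u' g G : ℝ → ℝ} {a : ℝ}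
    (hu : ∀ t ≥ a, HasDerivAt u (u' t) t) (hG : ∀ t, HasDerivAt G (g t) t)
    (h : ∀ t ≥ a, 0 < u t → u' t ≤ g t * u t) {t : ℝ} (ht : a ≤ t) :
    u t ≤ max (u a) 0 * Real.exp (G t - G a) := by
  set v : ℝ → ℝ := fun t => u t * Real.exp (-G t) with hv
  have hd : ∀ t ≥ a, HasDerivAt (fun t => max (v t) 0 ^ 2)
      (2 * max (v t) 0 * ((u' t - g t * u t) * Real.exp (-G t))) t := by
    intro t ht
    have h1 : HasDerivAt v ((u' t - g t * u t) * Real.exp (-G t)) t := by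
      refine ((hu t ht).mul (hG t).neg.exp).congr_deriv ?_
      rw [Pi.neg_apply]
      ring
    exact (hasDerivAt_sq_max_zero (v t)).comp t h1
  have hanti : AntitoneOn (fun t => max (v t) 0 ^ 2) (Ici a) := by
    refine antitoneOn_of_deriv_nonpos (convex_Ici a)
      (fun t ht => (hd t ht).continuousAt.continuousWithinAt)
      (fun t ht => (hd t (interior_subset ht)).differentiableAt.differentiableWithinAt) ?_
    intro t ht
    have ht : a ≤ t := interior_subset ht
    rw [(hd t ht).deriv]
    rcases le_or_gt (u t) 0 with h0 | h0
    · have : v t ≤ 0 := mul_nonpos_of_nonpos_of_nonneg h0 (Real.exp_pos _).le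
      simp [max_eq_right this]
    · exact mul_nonpos_of_nonneg_of_nonpos (by positivity)
        (mul_nonpos_of_nonpos_of_nonneg (by linarith [h t ht h0]) (Real.exp_pos _).le)
  have hle : max (v t) 0 ≤ max (v a) 0 :=
    (pow_le_pow_iff_left₀ (le_max_right _ _) (le_max_right _ _) two_ne_zero).1
      (hanti self_mem_Ici ht ht)
  have hva : max (v a) 0 = max (u a) 0 * Real.exp (-G a) := by
    simp only [hv]
    rw [max_mul_of_nonneg _ _ (Real.exp_pos _).le, zero_mul]
  calc u t = v t * Real.exp (G t) := by
        simp only [hv]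
        rw [mul_assoc, ← Real.exp_add]
        simp
    _ ≤ (max (u a) 0 * Real.exp (-G a)) * Real.exp (G t) := by
        rw [← hva]
        gcongr
        exact (le_max_left _ _).trans hle
    _ = max (u a) 0 * Real.exp (G t - G a) := by
        rw [mul_assoc, ← Real.exp_add]
        ring_nf

theorem nonpos_of_deriv_le {u u' : ℝ → ℝ} {a K : ℝ}
    (hu : ∀ t ≥ a, HasDerivAt u (u' t) t) (h : ∀ t ≥ a, 0 < u t → u' t ≤ K * u t)
    (ha : u a ≤ 0) {t : ℝ} (ht : a ≤ t) : u t ≤ 0 := by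
  have := le_max_mul_exp_of_deriv_le (G := fun t => K * t) (g := fun _ => K) hu
    (fun t => by simpa using (hasDerivAt_id t).const_mul K) h ht
  simpa [max_eq_right ha] using this

open scoped NNReal in
/-- A bounded vector field that is uniformly Lipschitz in space has global solutions: by
Picard–Lindelöf there are solutions on the intervals `[t₀ - n - 1, t₀ + n + 1]`, and these agree
where they overlap. -/
theorem exists_global_solution {f : ℝ → ℝ → ℝ} {K C : ℝ≥0} (hK : ∀ t, LipschitzWith K (f t))
    (hf : ∀ x, Continuous fun t => f t x) (hC : ∀ t x, |f t x| ≤ C) (t₀ ξ : ℝ) :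
    ∃ x : ℝ → ℝ, x t₀ = ξ ∧ ∀ t, HasDerivAt x (f t (x t)) t := by
  have hloc : ∀ n : ℕ, ∃ x : ℝ → ℝ, x t₀ = ξ ∧
      ∀ t ∈ Ioo (t₀ - (n + 1)) (t₀ + (n + 1)), HasDerivAt x (f t (x t)) t := by
    intro n
    have hn : (0 : ℝ) ≤ n := n.cast_nonneg
    have hP : IsPicardLindelof f (tmin := t₀ - (n + 1)) (tmax := t₀ + (n + 1))
        ⟨t₀, by constructor <;> linarith⟩ ξ (C * (n + 1)) 0 C K :=
      { lipschitzOnWith := fun t _ => (hK t).lipschitzOnWith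
        continuousOn := fun x _ => (hf x).continuousOn
        norm_le := fun t _ x _ => hC t x
        mul_max_le := by simp }
    obtain ⟨x, hx0, hx⟩ := hP.exists_eq_forall_mem_Icc_hasDerivWithinAt₀
    exact ⟨x, hx0, fun t ht => (hx t (Ioo_subset_Icc_self ht)).hasDerivAt
      (Icc_mem_nhds ht.1 ht.2)⟩
  choose x hx0 hx using hloc
  have hagree : ∀ n m : ℕ, n ≤ m → EqOn (x n) (x m) (Ioo (t₀ - (n + 1)) (t₀ + (n + 1))) := by
    intro n m hnm
    have hnm' : (n : ℝ) ≤ m := by exact_mod_cast hnm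
    have hn : (0 : ℝ) ≤ n := n.cast_nonneg
    refine ODE_solution_unique_of_mem_Ioo (t₀ := t₀) (s := fun _ => univ)
      (fun t _ => (hK t).lipschitzOnWith) (by constructor <;> linarith)
      (fun t ht => ⟨hx n t ht, mem_univ _⟩)
      (fun t ht => ⟨hx m t ⟨by linarith [ht.1], by linarith [ht.2]⟩, mem_univ _⟩)
      ((hx0 n).trans (hx0 m).symm)
  refine ⟨fun t => x ⌈|t - t₀|⌉₊ t, hx0 _, fun t => ?_⟩
  have hmem : ∀ s : ℝ, s ∈ Ioo (t₀ - ((⌈|s - t₀|⌉₊ : ℝ) + 1)) (t₀ + ((⌈|s - t₀|⌉₊ : ℝ) + 1)) := by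
    intro s
    have := abs_le.1 (Nat.le_ceil |s - t₀|)
    constructor <;> linarith [this.1, this.2]
  -- near `t`, the glued function is the single solution `x m`
  set m : ℕ := ⌈|t - t₀|⌉₊ + 1 with hm
  have heq : (fun s => x ⌈|s - t₀|⌉₊ s) =ᶠ[𝓝 t] x m := by
    have ho : IsOpen {s : ℝ | |s - t₀| < m} := isOpen_lt (by fun_prop) continuous_const
    have ht : t ∈ {s : ℝ | |s - t₀| < m} := by
      have := Nat.le_ceil |t - t₀|
      simp only [mem_ofPred_eq, hm]
      push_cast
      linarith
    filter_upwards [ho.mem_nhds ht] with s hs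
    exact hagree _ m (Nat.ceil_le.2 (le_of_lt hs)) (hmem s)
  have hmt : t ∈ Ioo (t₀ - ((m : ℝ) + 1)) (t₀ + ((m : ℝ) + 1)) := by
    have := hmem t
    simp only [hm]
    push_cast
    constructor <;> linarith [this.1, this.2]
  have := (hx m t hmt).congr_of_eventuallyEq heq
  rwa [← heq.eq_of_nhds] at this

/-! ### Contraction in the band, and the clipped equation -/

/-- The difference quotient of `rigidCubic · t` between `x` and `y`, as a polynomial; on the
diagonal it is the derivative. -/
noncomputable def rigidCubicSlope (x y t : ℝ) : ℝ :=
  1 / 10 - Real.cos t * (x + y) / 10 - Real.cos t ^ 2 * (x ^ 2 + x * y + y ^ 2)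

theorem rigidCubic_sub (x y t : ℝ) :
    rigidCubic x t - rigidCubic y t = rigidCubicSlope x y t * (x - y) := by
  unfold rigidCubic rigidCubicSlope
  ring

theorem deriv_rigidCubic (x t : ℝ) :
    deriv (fun x => rigidCubic x t) x = rigidCubicSlope x x t := by
  have h := (((hasDerivAt_id x).div_const 10).sub
    (((hasDerivAt_pow 2 x).const_mul (Real.cos t)).div_const 10)).sub
    ((hasDerivAt_pow 3 x).const_mul (Real.cos t ^ 2))
  refine (HasDerivAt.deriv (f := fun x => rigidCubic x t) h).trans ?_
  unfold rigidCubicSlope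
  norm_num
  ring

/-- The band of values in which the equation contracts on average. -/
abbrev band : Set ℝ := Icc (7 / 20) (27 / 50)

/-- An upper bound, independent of the solutions, for the contraction rate in the band. -/
noncomputable def bandRate (t : ℝ) : ℝ :=
  -69 / 1000 - 89 / 1000 * Real.cos t - 174 / 1000 * Real.cos (2 * t)

/-- The antiderivative of `bandRate` vanishing at `0`. -/
noncomputable def bandRatePrim (t : ℝ) : ℝ :=
  -69 / 1000 * t - 89 / 1000 * Real.sin t - 87 / 1000 * Real.sin (2 * t)

theorem hasDerivAt_bandRatePrim (t : ℝ) : HasDerivAt bandRatePrim (bandRate t) t := by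
  have h2 : HasDerivAt (fun t : ℝ => Real.sin (2 * t)) (Real.cos (2 * t) * 2) t := by
    simpa using ((hasDerivAt_id t).const_mul 2).sin
  refine ((((hasDerivAt_id t).const_mul (-69 / 1000)).sub
    ((Real.hasDerivAt_sin t).const_mul (89 / 1000))).sub (h2.const_mul (87 / 1000))).congr_deriv ?_
  unfold bandRate
  ring

theorem bandRatePrim_sub_le (s t : ℝ) :
    bandRatePrim t - bandRatePrim s ≤ 2 / 5 - 69 / 1000 * (t - s) := by
  unfold bandRatePrim
  linarith [Real.sin_le_one s, Real.sin_le_one (2 * s), Real.neg_one_le_sin t,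
    Real.neg_one_le_sin (2 * t)]

theorem exp_two_fifths_le : Real.exp (2 / 5) ≤ 2 := by
  have h := Real.exp_bound' (x := 2 / 5) (by norm_num) (by norm_num) (n := 3) (by norm_num)
  refine h.trans ?_
  norm_num [Finset.sum_range_succ, Nat.factorial]

theorem exp_bandRatePrim_sub_le (s t : ℝ) :
    Real.exp (bandRatePrim t - bandRatePrim s) ≤ 2 * Real.exp (-69 / 1000 * (t - s)) := by
  calc Real.exp (bandRatePrim t - bandRatePrim s)
      ≤ Real.exp (2 / 5 + -69 / 1000 * (t - s)) :=
        Real.exp_le_exp.2 (by linarith [bandRatePrim_sub_le s t])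
    _ ≤ 2 * Real.exp (-69 / 1000 * (t - s)) := by
        rw [Real.exp_add]
        gcongr
        exact exp_two_fifths_le

theorem rigidCubicSlope_le_bandRate {x y : ℝ} (hx : x ∈ band) (hy : y ∈ band) (t : ℝ) :
    rigidCubicSlope x y t ≤ bandRate t := by
  unfold rigidCubicSlope bandRate
  rw [Real.cos_two_mul]
  set c := Real.cos t
  obtain ⟨hx1, hx2⟩ := hx
  obtain ⟨hy1, hy2⟩ := hy
  -- `x ^ 2 + x * y + y ^ 2 ≥ 3 * (7 / 20) ^ 2`, and `x + y` is within `19 / 100` of `89 / 100`.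
  have h1 : 147 / 400 * c ^ 2 ≤ c ^ 2 * (x ^ 2 + x * y + y ^ 2) := by
    rw [mul_comm]
    gcongr
    nlinarith
  have h2 : -(c * (x + y)) ≤ -89 / 100 * c + 19 / 100 * |c| := by
    have h : |x + y - 89 / 100| ≤ 19 / 100 := abs_le.2 ⟨by linarith, by linarith⟩
    have h3 : |c * (x + y - 89 / 100)| ≤ |c| * (19 / 100) := by rw [abs_mul]; gcongr
    linarith [neg_abs_le (c * (x + y - 89 / 100))]
  nlinarith [sq_abs c, sq_nonneg (|c| - 1 / 2)]

theorem abs_rigidCubicSlope_le {R x y : ℝ} (hx : |x| ≤ R) (hy : |y| ≤ R) (t : ℝ) :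
    |rigidCubicSlope x y t| ≤ 1 / 10 + R / 5 + 3 * R ^ 2 := by
  have hR : 0 ≤ R := (abs_nonneg x).trans hx
  have hc := Real.abs_cos_le_one t
  have h1 : |Real.cos t * (x + y)| ≤ 1 * (R + R) := by
    rw [abs_mul]
    gcongr
    exact (abs_add_le x y).trans (add_le_add hx hy)
  have h2 : |Real.cos t ^ 2 * (x ^ 2 + x * y + y ^ 2)| ≤ 1 * (R ^ 2 + R * R + R ^ 2) := by
    rw [abs_mul, abs_pow]
    gcongr
    · exact pow_le_one₀ (abs_nonneg _) hc
    · refine (abs_add_le _ _).trans (add_le_add ((abs_add_le _ _).trans (add_le_add ?_ ?_)) ?_)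
      · rw [abs_pow]; gcongr
      · rw [abs_mul]; gcongr
      · rw [abs_pow]; gcongr
  unfold rigidCubicSlope
  have h1' := abs_le.1 h1
  have h2' := abs_le.1 h2
  exact abs_le.2 ⟨by linarith [h1'.1, h1'.2, h2'.1, h2'.2],
    by linarith [h1'.1, h1'.2, h2'.1, h2'.2]⟩

theorem abs_le_of_mem_band {x : ℝ} (hx : x ∈ band) : |x| ≤ 27 / 50 :=
  abs_le.2 ⟨by linarith [hx.1], hx.2⟩

theorem abs_rigidCubicSlope_le_two {x y : ℝ} (hx : x ∈ band) (hy : y ∈ band) (t : ℝ) :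
    |rigidCubicSlope x y t| ≤ 2 :=
  (abs_rigidCubicSlope_le (abs_le_of_mem_band hx) (abs_le_of_mem_band hy) t).trans (by norm_num)

theorem abs_rigidCubicSlope_sub_diag_le {x y : ℝ} (hx : x ∈ band) (hy : y ∈ band) (t : ℝ) :
    |rigidCubicSlope x y t - rigidCubicSlope y y t| ≤ 2 * |x - y| := by
  have h : rigidCubicSlope x y t - rigidCubicSlope y y t
      = -(Real.cos t / 10 + Real.cos t ^ 2 * (x + 2 * y)) * (x - y) := by
    unfold rigidCubicSlope
    ring
  rw [h, abs_mul, abs_neg]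
  gcongr
  have h0 := Real.cos_le_one t
  have h1 := Real.neg_one_le_cos t
  have h2 : 0 ≤ Real.cos t ^ 2 * (x + 2 * y) :=
    mul_nonneg (sq_nonneg _) (by linarith [hx.1, hy.1])
  have h3 : Real.cos t ^ 2 * (x + 2 * y) ≤ 1 * (x + 2 * y) := by
    gcongr
    · linarith [hx.1, hy.1]
    · exact Real.cos_sq_le_one t
  exact abs_le.2 ⟨by linarith, by linarith [hx.2, hy.2]⟩

/-- Projection of the line onto the band. -/
noncomputable def clip (x : ℝ) : ℝ := max (7 / 20) (min x (27 / 50))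

theorem clip_mem_band (x : ℝ) : clip x ∈ band :=
  ⟨le_max_left _ _, max_le (by norm_num) (min_le_right _ _)⟩

theorem clip_of_mem_band {x : ℝ} (hx : x ∈ band) : clip x = x := by
  rw [clip, min_eq_left hx.2, max_eq_right hx.1]

theorem abs_clip_sub_le (x y : ℝ) : |clip x - clip y| ≤ |x - y| := by
  unfold clip
  refine (abs_max_sub_max_le_max _ _ _ _).trans ?_
  simp only [sub_self, abs_zero]
  refine max_le (abs_nonneg _) ((abs_min_sub_min_le_max _ _ _ _).trans ?_)
  simp

/-- The equation with its right-hand side frozen outside the band: bounded and globally Lipschitz,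
so that all its solutions are global, and equal to the original one inside the band. -/
noncomputable def clippedCubic (x t : ℝ) : ℝ := rigidCubic (clip x) t

theorem clippedCubic_of_mem_band {x : ℝ} (hx : x ∈ band) (t : ℝ) :
    clippedCubic x t = rigidCubic x t := by
  rw [clippedCubic, clip_of_mem_band hx]

theorem abs_clippedCubic_sub_le (x y t : ℝ) :
    |clippedCubic x t - clippedCubic y t| ≤ 2 * |x - y| := by
  unfold clippedCubic
  rw [rigidCubic_sub, abs_mul]
  exact mul_le_mul (abs_rigidCubicSlope_le_two (clip_mem_band x) (clip_mem_band y) t)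
    (abs_clip_sub_le x y) (abs_nonneg _) (by norm_num)

theorem lipschitzWith_clippedCubic (t : ℝ) : LipschitzWith 2 fun x => clippedCubic x t :=
  LipschitzWith.of_dist_le_mul fun x y => by
    simpa [Real.dist_eq] using abs_clippedCubic_sub_le x y t

theorem abs_clippedCubic_le (x t : ℝ) : |clippedCubic x t| ≤ 2 := by
  have h : clippedCubic x t = rigidCubicSlope (clip x) 0 t * clip x := by
    have := rigidCubic_sub (clip x) 0 t
    have h0 : rigidCubic 0 t = 0 := by simp [rigidCubic]
    rw [h0, sub_zero, sub_zero] at this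
    exact this
  have hx := abs_le_of_mem_band (clip_mem_band x)
  have h1 := abs_rigidCubicSlope_le (y := 0) hx (by norm_num) t
  rw [h, abs_mul]
  calc _ ≤ (1 / 10 + 27 / 50 / 5 + 3 * (27 / 50) ^ 2) * (27 / 50 : ℝ) := by gcongr
    _ ≤ 2 := by norm_num

/-- A solution, on the whole line, of the clipped equation. -/
def IsClippedSolution (x : ℝ → ℝ) : Prop := ∀ t, HasDerivAt x (clippedCubic (x t) t) t

theorem exists_isClippedSolution (t₀ ξ : ℝ) : ∃ x, x t₀ = ξ ∧ IsClippedSolution x :=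
  exists_global_solution (f := fun t x => clippedCubic x t) (K := 2) (C := 2)
    lipschitzWith_clippedCubic (fun x => by unfold clippedCubic rigidCubic; fun_prop)
    (fun t x => abs_clippedCubic_le x t) t₀ ξ

theorem IsClippedSolution.ext {x y : ℝ → ℝ} (hx : IsClippedSolution x) (hy : IsClippedSolution y)
    {t₀ : ℝ} (h : x t₀ = y t₀) : x = y :=
  ODE_solution_unique_univ (v := fun t x => clippedCubic x t) (s := fun _ => univ)
    (fun t => (lipschitzWith_clippedCubic t).lipschitzOnWith) (fun t => ⟨hx t, mem_univ _⟩)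
    (fun t => ⟨hy t, mem_univ _⟩) h

theorem IsClippedSolution.continuous {x : ℝ → ℝ} (hx : IsClippedSolution x) : Continuous x :=
  continuous_iff_continuousAt.2 fun t => (hx t).continuousAt

theorem IsClippedSolution.hasDerivAt_rigidCubic {x : ℝ → ℝ} (hx : IsClippedSolution x) {t : ℝ}
    (h : x t ∈ band) : HasDerivAt x (rigidCubic (x t) t) t :=
  clippedCubic_of_mem_band h t ▸ hx t

/-- A subsolution that starts below a solution stays below it. The differential inequality need not
be strict because the clipped equation is Lipschitz. -/
theorem IsClippedSolution.ge_of_subsolution {x a a' : ℝ → ℝ} (hx : IsClippedSolution x) {t₀ : ℝ}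
    (ha : ∀ t ≥ t₀, HasDerivAt a (a' t) t) (hsub : ∀ t ≥ t₀, a' t ≤ clippedCubic (a t) t)
    (h₀ : a t₀ ≤ x t₀) {t : ℝ} (ht : t₀ ≤ t) : a t ≤ x t := by
  refine sub_nonpos.1 (nonpos_of_deriv_le (u := fun t => a t - x t) (K := 2)
    (fun t ht => (ha t ht).sub (hx t)) (fun t ht hpos => ?_) (sub_nonpos.2 h₀) ht)
  have h := abs_le.1 (abs_clippedCubic_sub_le (a t) (x t) t)
  rw [abs_of_pos hpos] at h
  linarith [h.2, hsub t ht]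

theorem IsClippedSolution.le_of_supersolution {x b b' : ℝ → ℝ} (hx : IsClippedSolution x) {t₀ : ℝ}
    (hb : ∀ t ≥ t₀, HasDerivAt b (b' t) t) (hsup : ∀ t ≥ t₀, clippedCubic (b t) t ≤ b' t)
    (h₀ : x t₀ ≤ b t₀) {t : ℝ} (ht : t₀ ≤ t) : x t ≤ b t := by
  refine sub_nonpos.1 (nonpos_of_deriv_le (u := fun t => x t - b t) (K := 2)
    (fun t ht => (hx t).sub (hb t ht)) (fun t ht hpos => ?_) (sub_nonpos.2 h₀) ht)
  have h := abs_le.1 (abs_clippedCubic_sub_le (x t) (b t) t)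
  rw [abs_of_pos hpos] at h
  linarith [h.2, hsup t ht]

/-! ### The barriers -/

/-- Reciprocal of the lower barrier. Its coefficients are those, up to order two, of `1 / r` for the
numerical periodic solution `r`, with the constant term raised by about `0.12` and slight adjustments
that enlarge the margins below. In the variable `u = 1 / r` the equation reads
`u u' + u ^ 2 / 10 - u cos t / 10 - cos² t = 0`. -/
noncomputable def lowerRecip (t : ℝ) : ℝ :=
  2358 / 1000 + 97 / 1000 * Real.sin t + 15 / 1000 * Real.cos t + 105 / 1000 * Real.sin (2 * t)
    + 10 / 1000 * Real.cos (2 * t)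

/-- The derivative of `lowerRecip`. -/
noncomputable def lowerRecipDeriv (t : ℝ) : ℝ :=
  97 / 1000 * Real.cos t - 15 / 1000 * Real.sin t + 210 / 1000 * Real.cos (2 * t)
    - 20 / 1000 * Real.sin (2 * t)

/-- Reciprocal of the upper barrier, obtained like `lowerRecip` but with the constant term lowered by
about `0.1`. -/
noncomputable def upperRecip (t : ℝ) : ℝ :=
  2134 / 1000 + 97 / 1000 * Real.sin t + 14 / 1000 * Real.cos t + 116 / 1000 * Real.sin (2 * t)
    + 12 / 1000 * Real.cos (2 * t)

/-- The derivative of `upperRecip`. -/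
noncomputable def upperRecipDeriv (t : ℝ) : ℝ :=
  97 / 1000 * Real.cos t - 14 / 1000 * Real.sin t + 232 / 1000 * Real.cos (2 * t)
    - 24 / 1000 * Real.sin (2 * t)

theorem hasDerivAt_trigPoly (a b c d e t : ℝ) :
    HasDerivAt (fun t => a + b * Real.sin t + c * Real.cos t + d * Real.sin (2 * t)
      + e * Real.cos (2 * t))
      (b * Real.cos t - c * Real.sin t + 2 * d * Real.cos (2 * t) - 2 * e * Real.sin (2 * t)) t := by
  have h2 : HasDerivAt (fun t : ℝ => 2 * t) 2 t := by simpa using (hasDerivAt_id t).const_mul 2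
  refine ((((hasDerivAt_const t a).add ((Real.hasDerivAt_sin t).const_mul b)).add
    ((Real.hasDerivAt_cos t).const_mul c)).add (h2.sin.const_mul d)).add (h2.cos.const_mul e)
    |>.congr_deriv ?_
  ring

theorem hasDerivAt_lowerRecip (t : ℝ) : HasDerivAt lowerRecip (lowerRecipDeriv t) t := by
  refine (hasDerivAt_trigPoly _ _ _ _ _ t).congr_deriv ?_
  unfold lowerRecipDeriv
  ring

theorem hasDerivAt_upperRecip (t : ℝ) : HasDerivAt upperRecip (upperRecipDeriv t) t := by
  refine (hasDerivAt_trigPoly _ _ _ _ _ t).congr_deriv ?_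
  unfold upperRecipDeriv
  ring

theorem lowerRecip_mem_Icc (t : ℝ) : lowerRecip t ∈ Icc 2 (5 / 2 + 1 / 10) := by
  unfold lowerRecip
  constructor <;>
  linarith [Real.sin_le_one t, Real.sin_le_one (2 * t), Real.neg_one_le_sin t,
    Real.neg_one_le_sin (2 * t), Real.cos_le_one t, Real.cos_le_one (2 * t),
    Real.neg_one_le_cos t, Real.neg_one_le_cos (2 * t)]

theorem upperRecip_mem_Icc (t : ℝ) : upperRecip t ∈ Icc (189 / 100) (12 / 5) := by
  unfold upperRecip
  constructor <;>
  linarith [Real.sin_le_one t, Real.sin_le_one (2 * t), Real.neg_one_le_sin t,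
    Real.neg_one_le_sin (2 * t), Real.cos_le_one t, Real.cos_le_one (2 * t),
    Real.neg_one_le_cos t, Real.neg_one_le_cos (2 * t)]

theorem sin_four_mul (t : ℝ) :
    Real.sin (4 * t) = 4 * Real.sin t * (2 * Real.cos t ^ 3 - Real.cos t) := by
  rw [show 4 * t = 2 * (2 * t) by ring, Real.sin_two_mul, Real.sin_two_mul, Real.cos_two_mul]
  ring

theorem cos_four_mul (t : ℝ) :
    Real.cos (4 * t) = 8 * Real.cos t ^ 4 - 8 * Real.cos t ^ 2 + 1 := by
  rw [show 4 * t = 2 * (2 * t) by ring, Real.cos_two_mul, Real.cos_two_mul]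
  ring

theorem sin_three_mul_eq (t : ℝ) :
    Real.sin (3 * t) = Real.sin t * (4 * Real.cos t ^ 2 - 1) := by
  rw [Real.sin_three_mul]
  linear_combination 4 * Real.sin t * Real.sin_sq_add_cos_sq t * (-1)

theorem sin_five_mul (t : ℝ) :
    Real.sin (5 * t) = Real.sin t * (16 * Real.cos t ^ 4 - 12 * Real.cos t ^ 2 + 1) := by
  rw [show 5 * t = 4 * t + t by ring, Real.sin_add, sin_four_mul, cos_four_mul]
  ring

theorem cos_five_mul (t : ℝ) :
    Real.cos (5 * t) = 16 * Real.cos t ^ 5 - 20 * Real.cos t ^ 3 + 5 * Real.cos t := by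
  rw [show 5 * t = 4 * t + t by ring, Real.cos_add, sin_four_mul, cos_four_mul]
  linear_combination (-4 * (2 * Real.cos t ^ 3 - Real.cos t)) * Real.sin_sq_add_cos_sq t

/-- The bounds `|sin (n t)|, |cos (n t)| ≤ 1` for `3 ≤ n ≤ 5`, in the normal form `p(cos t)`,
`sin t * p(cos t)` in which trigonometric polynomials are compared below. -/
theorem harmonics_bounds (t : ℝ) :
    |Real.sin t * (4 * Real.cos t ^ 2 - 1)| ≤ 1 ∧
    |4 * Real.cos t ^ 3 - 3 * Real.cos t| ≤ 1 ∧
    |4 * Real.sin t * (2 * Real.cos t ^ 3 - Real.cos t)| ≤ 1 ∧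
    |8 * Real.cos t ^ 4 - 8 * Real.cos t ^ 2 + 1| ≤ 1 ∧
    |Real.sin t * (16 * Real.cos t ^ 4 - 12 * Real.cos t ^ 2 + 1)| ≤ 1 ∧
    |16 * Real.cos t ^ 5 - 20 * Real.cos t ^ 3 + 5 * Real.cos t| ≤ 1 := by
  rw [← sin_three_mul_eq, ← Real.cos_three_mul, ← sin_four_mul, ← cos_four_mul, ← sin_five_mul,
    ← cos_five_mul]
  exact ⟨Real.abs_sin_le_one _, Real.abs_cos_le_one _, Real.abs_sin_le_one _,
    Real.abs_cos_le_one _, Real.abs_sin_le_one _, Real.abs_cos_le_one _⟩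

/-- Every harmonic is estimated by its amplitude; the constant term dominates. -/
theorem lowerRecip_residual_nonneg (t : ℝ) :
    0 ≤ lowerRecip t * lowerRecipDeriv t + lowerRecip t ^ 2 / 10 - lowerRecip t * Real.cos t / 10
      - Real.cos t ^ 2 := by
  unfold lowerRecip lowerRecipDeriv
  have s2 := Real.sin_sq t
  have a1 := abs_le.1 (Real.abs_sin_le_one t)
  have b1 := abs_le.1 (Real.abs_cos_le_one t)
  have a2 := abs_le.1 (Real.abs_sin_le_one (2 * t))
  have b2 := abs_le.1 (Real.abs_cos_le_one (2 * t))
  obtain ⟨a3, b3, a4, b4, a5, b5⟩ := harmonics_bounds t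
  rw [abs_le] at a3 b3 a4 b4 a5 b5
  rw [Real.sin_two_mul] at *
  rw [Real.cos_two_mul] at *
  set s := Real.sin t
  set c := Real.cos t
  ring_nf at *
  simp only [s2] at *
  ring_nf at *
  linarith

theorem upperRecip_residual_nonpos (t : ℝ) :
    upperRecip t * upperRecipDeriv t + upperRecip t ^ 2 / 10 - upperRecip t * Real.cos t / 10
      - Real.cos t ^ 2 ≤ 0 := by
  unfold upperRecip upperRecipDeriv
  have s2 := Real.sin_sq t
  have a1 := abs_le.1 (Real.abs_sin_le_one t)
  have b1 := abs_le.1 (Real.abs_cos_le_one t)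
  have a2 := abs_le.1 (Real.abs_sin_le_one (2 * t))
  have b2 := abs_le.1 (Real.abs_cos_le_one (2 * t))
  obtain ⟨a3, b3, a4, b4, a5, b5⟩ := harmonics_bounds t
  rw [abs_le] at a3 b3 a4 b4 a5 b5
  rw [Real.sin_two_mul] at *
  rw [Real.cos_two_mul] at *
  set s := Real.sin t
  set c := Real.cos t
  ring_nf at *
  simp only [s2] at *
  ring_nf at *
  linarith

theorem rBar_sub_mul_lowerRecip_le (t : ℝ) : (rBar t - 0.042) * lowerRecip t ≤ 1 := by
  unfold lowerRecip rBar
  have s2 := Real.sin_sq t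
  have a1 := abs_le.1 (Real.abs_sin_le_one t)
  have b1 := abs_le.1 (Real.abs_cos_le_one t)
  have a2 := abs_le.1 (Real.abs_sin_le_one (2 * t))
  have b2 := abs_le.1 (Real.abs_cos_le_one (2 * t))
  obtain ⟨a3, b3, a4, b4, a5, b5⟩ := harmonics_bounds t
  rw [abs_le] at a3 b3 a4 b4 a5 b5
  rw [Real.cos_three_mul]
  rw [Real.sin_two_mul] at *
  rw [Real.cos_two_mul] at *
  set s := Real.sin t
  set c := Real.cos t
  ring_nf at *
  simp only [s2] at *
  ring_nf at *
  linarith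

theorem le_rBar_add_mul_upperRecip (t : ℝ) : 1 ≤ (rBar t + 0.042) * upperRecip t := by
  unfold upperRecip rBar
  have s2 := Real.sin_sq t
  have a1 := abs_le.1 (Real.abs_sin_le_one t)
  have b1 := abs_le.1 (Real.abs_cos_le_one t)
  have a2 := abs_le.1 (Real.abs_sin_le_one (2 * t))
  have b2 := abs_le.1 (Real.abs_cos_le_one (2 * t))
  obtain ⟨a3, b3, a4, b4, a5, b5⟩ := harmonics_bounds t
  rw [abs_le] at a3 b3 a4 b4 a5 b5
  rw [Real.cos_three_mul]
  rw [Real.sin_two_mul] at *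
  rw [Real.cos_two_mul] at *
  set s := Real.sin t
  set c := Real.cos t
  ring_nf at *
  simp only [s2] at *
  ring_nf at *
  linarith

theorem rBar_mem_Icc (t : ℝ) : rBar t ∈ Icc (2 / 5 - 1 / 500) (49 / 100 + 1 / 500) := by
  unfold rBar
  constructor <;>
  linarith [Real.sin_le_one t, Real.sin_le_one (2 * t), Real.neg_one_le_sin t,
    Real.neg_one_le_sin (2 * t), Real.cos_le_one t, Real.cos_le_one (2 * t),
    Real.neg_one_le_cos t, Real.neg_one_le_cos (2 * t), Real.cos_le_one (3 * t),
    Real.neg_one_le_cos (3 * t)]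

theorem mem_band_of_abs_rBar_sub_le {x t : ℝ} (h : |rBar t - x| ≤ 0.042) : x ∈ band := by
  have h1 := rBar_mem_Icc t
  have h2 := abs_le.1 h
  norm_num at h2
  constructor <;> linarith [h1.1, h1.2, h2.1, h2.2]

/-- The lower barrier. -/
noncomputable def lowerBarrier (t : ℝ) : ℝ := (lowerRecip t)⁻¹

/-- The upper barrier. -/
noncomputable def upperBarrier (t : ℝ) : ℝ := (upperRecip t)⁻¹

theorem lowerRecip_pos (t : ℝ) : 0 < lowerRecip t := by linarith [(lowerRecip_mem_Icc t).1]

theorem upperRecip_pos (t : ℝ) : 0 < upperRecip t := by linarith [(upperRecip_mem_Icc t).1]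

theorem hasDerivAt_lowerBarrier (t : ℝ) :
    HasDerivAt lowerBarrier (-lowerRecipDeriv t / lowerRecip t ^ 2) t :=
  (hasDerivAt_lowerRecip t).inv (lowerRecip_pos t).ne'

theorem hasDerivAt_upperBarrier (t : ℝ) :
    HasDerivAt upperBarrier (-upperRecipDeriv t / upperRecip t ^ 2) t :=
  (hasDerivAt_upperRecip t).inv (upperRecip_pos t).ne'

/-- The inner band, in which the barriers lie; solutions starting within `1 / 100` of it are still
in `band`. -/
abbrev innerBand : Set ℝ := Icc (9 / 25) (53 / 100)

theorem innerBand_subset_band : innerBand ⊆ band := Icc_subset_Icc (by norm_num) (by norm_num)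

theorem lowerBarrier_mem (t : ℝ) : lowerBarrier t ∈ innerBand := by
  obtain ⟨h1, h2⟩ := lowerRecip_mem_Icc t
  unfold lowerBarrier
  constructor
  · rw [le_inv_comm₀ (by norm_num) (lowerRecip_pos t)]
    exact h2.trans (by norm_num)
  · rw [inv_le_comm₀ (lowerRecip_pos t) (by norm_num)]
    exact le_trans (by norm_num) h1

theorem upperBarrier_mem (t : ℝ) : upperBarrier t ∈ innerBand := by
  obtain ⟨h1, h2⟩ := upperRecip_mem_Icc t
  unfold upperBarrier
  constructor
  · rw [le_inv_comm₀ (by norm_num) (upperRecip_pos t)]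
    exact h2.trans (by norm_num)
  · rw [inv_le_comm₀ (upperRecip_pos t) (by norm_num)]
    exact le_trans (by norm_num) h1

/-- The defect of `1 / u` as a solution is, up to the factor `u⁻³`, the residual of `u`. -/
theorem rigidCubic_inv_sub {u : ℝ} (hu : u ≠ 0) (u' t : ℝ) :
    rigidCubic u⁻¹ t - -u' / u ^ 2
      = (u * u' + u ^ 2 / 10 - u * Real.cos t / 10 - Real.cos t ^ 2) / u ^ 3 := by
  unfold rigidCubic
  field_simp
  ring

theorem lowerBarrier_subsolution (t : ℝ) :
    -lowerRecipDeriv t / lowerRecip t ^ 2 ≤ clippedCubic (lowerBarrier t) t := by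
  rw [clippedCubic_of_mem_band (innerBand_subset_band (lowerBarrier_mem t)), ← sub_nonneg,
    lowerBarrier, rigidCubic_inv_sub (lowerRecip_pos t).ne']
  exact div_nonneg (lowerRecip_residual_nonneg t) (pow_pos (lowerRecip_pos t) 3).le

theorem upperBarrier_supersolution (t : ℝ) :
    clippedCubic (upperBarrier t) t ≤ -upperRecipDeriv t / upperRecip t ^ 2 := by
  rw [clippedCubic_of_mem_band (innerBand_subset_band (upperBarrier_mem t)), ← sub_nonpos,
    upperBarrier, rigidCubic_inv_sub (upperRecip_pos t).ne']
  exact div_nonpos_of_nonpos_of_nonneg (upperRecip_residual_nonpos t)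
    (pow_pos (upperRecip_pos t) 3).le

theorem rBar_sub_le_lowerBarrier (t : ℝ) : rBar t - 0.042 ≤ lowerBarrier t := by
  rw [lowerBarrier, ← one_div, le_div_iff₀ (lowerRecip_pos t)]
  exact rBar_sub_mul_lowerRecip_le t

theorem upperBarrier_le_rBar_add (t : ℝ) : upperBarrier t ≤ rBar t + 0.042 := by
  rw [upperBarrier, ← one_div, div_le_iff₀ (upperRecip_pos t)]
  exact le_rBar_add_mul_upperRecip t

theorem lowerBarrier_le_upperBarrier (t : ℝ) : lowerBarrier t ≤ upperBarrier t := by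
  unfold lowerBarrier upperBarrier
  refine inv_anti₀ (upperRecip_pos t) ?_
  unfold upperRecip lowerRecip
  linarith [Real.cos_le_one (2 * t), Real.neg_one_le_cos t, Real.sin_le_one (2 * t)]

theorem periodic_lowerBarrier : Function.Periodic lowerBarrier (2 * Real.pi) := fun t => by
  have h : 2 * (t + 2 * Real.pi) = 2 * t + (2 : ℕ) * (2 * Real.pi) := by push_cast; ring
  simp only [lowerBarrier, lowerRecip, Real.sin_add_two_pi, Real.cos_add_two_pi, h,
    Real.sin_add_nat_mul_two_pi, Real.cos_add_nat_mul_two_pi]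

theorem periodic_upperBarrier : Function.Periodic upperBarrier (2 * Real.pi) := fun t => by
  have h : 2 * (t + 2 * Real.pi) = 2 * t + (2 : ℕ) * (2 * Real.pi) := by push_cast; ring
  simp only [upperBarrier, upperRecip, Real.sin_add_two_pi, Real.cos_add_two_pi, h,
    Real.sin_add_nat_mul_two_pi, Real.cos_add_nat_mul_two_pi]

/-! ### The periodic solution and the solutions near it -/

theorem clippedCubic_add_two_pi (x t : ℝ) :
    clippedCubic x (t + 2 * Real.pi) = clippedCubic x t := by
  simp [clippedCubic, rigidCubic]

theorem IsClippedSolution.comp_add_two_pi {x : ℝ → ℝ} (hx : IsClippedSolution x) :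
    IsClippedSolution fun t => x (t + 2 * Real.pi) := fun t => by
  have h := (hx (t + 2 * Real.pi)).comp_add_const t (2 * Real.pi)
  rwa [clippedCubic_add_two_pi] at h

theorem IsClippedSolution.sub_le {x y : ℝ → ℝ} (hx : IsClippedSolution x)
    (hy : IsClippedSolution y) {t₀ t : ℝ} (ht : t₀ ≤ t) :
    x t - y t ≤ |x t₀ - y t₀| * Real.exp (2 * t - 2 * t₀) := by
  have h := le_max_mul_exp_of_deriv_le (u := fun t => x t - y t) (g := fun _ => 2)
    (G := fun t => 2 * t) (a := t₀) (fun t _ => (hx t).sub (hy t))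
    (fun t => by simpa using (hasDerivAt_id t).const_mul 2)
    (fun t _ hpos => by
      have := abs_le.1 (abs_clippedCubic_sub_le (x t) (y t) t)
      rw [abs_of_pos hpos] at this
      exact this.2) ht
  refine h.trans ?_
  gcongr
  exact max_le (le_abs_self _) (abs_nonneg _)

theorem IsClippedSolution.abs_sub_le {x y : ℝ → ℝ} (hx : IsClippedSolution x)
    (hy : IsClippedSolution y) {t₀ t : ℝ} (ht : t₀ ≤ t) :
    |x t - y t| ≤ |x t₀ - y t₀| * Real.exp (2 * t - 2 * t₀) := by
  refine abs_le.2 ⟨?_, hx.sub_le hy ht⟩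
  have := hy.sub_le hx ht
  rw [abs_sub_comm] at this
  linarith

/-- The time-`2π` map of the clipped equation preserves the interval between the two barriers;
a fixed point of it is the initial value of a periodic solution between the barriers. -/
theorem exists_periodic_isClippedSolution :
    ∃ r : ℝ → ℝ, IsClippedSolution r ∧ Function.Periodic r (2 * Real.pi) ∧
      ∀ t, r t ∈ Icc (lowerBarrier t) (upperBarrier t) := by
  choose Φ hΦ0 hΦ using exists_isClippedSolution 0
  have hpi : (0 : ℝ) ≤ 2 * Real.pi := by positivity
  have hbetween : ∀ ξ ∈ Icc (lowerBarrier 0) (upperBarrier 0), ∀ t ≥ 0,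
      Φ ξ t ∈ Icc (lowerBarrier t) (upperBarrier t) := fun ξ hξ t ht =>
    ⟨(hΦ ξ).ge_of_subsolution (fun t _ => hasDerivAt_lowerBarrier t)
        (fun t _ => lowerBarrier_subsolution t) ((hΦ0 ξ).symm ▸ hξ.1) ht,
      (hΦ ξ).le_of_supersolution (fun t _ => hasDerivAt_upperBarrier t)
        (fun t _ => upperBarrier_supersolution t) ((hΦ0 ξ).symm ▸ hξ.2) ht⟩
  have hmaps : MapsTo (fun ξ => Φ ξ (2 * Real.pi)) (Icc (lowerBarrier 0) (upperBarrier 0))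
      (Icc (lowerBarrier 0) (upperBarrier 0)) := fun ξ hξ => by
    have := hbetween ξ hξ _ hpi
    rwa [← zero_add (2 * Real.pi), periodic_lowerBarrier, periodic_upperBarrier, zero_add] at this
  have hcont : Continuous fun ξ => Φ ξ (2 * Real.pi) := by
    refine (LipschitzWith.of_dist_le' (K := Real.exp (2 * (2 * Real.pi) - 2 * 0))
      fun ξ η => ?_).continuous
    have := (hΦ ξ).abs_sub_le (hΦ η) hpi
    rw [hΦ0, hΦ0] at this
    exact this.trans_eq (mul_comm _ _)
  obtain ⟨ξ, hξ, hfix⟩ := exists_mem_Icc_isFixedPt_of_mapsTo hcont.continuousOn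
    (lowerBarrier_le_upperBarrier 0) hmaps
  have hper : Function.Periodic (Φ ξ) (2 * Real.pi) := by
    refine congrFun ((hΦ ξ).comp_add_two_pi.ext (hΦ ξ) (t₀ := 0) ?_)
    rw [zero_add, hΦ0]
    exact hfix
  refine ⟨Φ ξ, hΦ ξ, hper, fun t => ?_⟩
  obtain ⟨n, hn⟩ := exists_nat_ge (-t / (2 * Real.pi))
  have hn' : 0 ≤ t + n * (2 * Real.pi) := by
    rw [div_le_iff₀ (by positivity)] at hn
    linarith
  have h := hbetween ξ hξ _ hn'
  rwa [hper.nat_mul n t, periodic_lowerBarrier.nat_mul n t, periodic_upperBarrier.nat_mul n t] at h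

/-- Solutions starting near a solution in the inner band are attracted to it at the rate
`bandRate`: the curves at distance `δ exp (∫ bandRate)` above and below it are barriers as long as
they remain in the band. -/
theorem IsClippedSolution.abs_sub_le_exp {r x : ℝ → ℝ} (hr : IsClippedSolution r)
    (hr' : ∀ t, r t ∈ innerBand) (hx : IsClippedSolution x) {t₀ : ℝ}
    (h₀ : |x t₀ - r t₀| ≤ 1 / 200) {t : ℝ} (ht : t₀ ≤ t) :
    |x t - r t| ≤ |x t₀ - r t₀| * Real.exp (bandRatePrim t - bandRatePrim t₀) := by
  set w : ℝ → ℝ := fun t => |x t₀ - r t₀| * Real.exp (bandRatePrim t - bandRatePrim t₀) with hw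
  have hw0 : w t₀ = |x t₀ - r t₀| := by simp [hw]
  have hwnn : ∀ t, 0 ≤ w t := fun t => by positivity
  have hwd : ∀ t, HasDerivAt w (bandRate t * w t) t := fun t => by
    refine (((hasDerivAt_bandRatePrim t).sub_const _).exp.const_mul _).congr_deriv ?_
    simp only [hw]
    ring
  have hwle : ∀ t ≥ t₀, w t ≤ 1 / 100 := fun t ht => by
    have h1 : Real.exp (-69 / 1000 * (t - t₀)) ≤ 1 :=
      Real.exp_le_one_iff.2 (by nlinarith)
    calc w t ≤ 1 / 200 * (2 * 1) := by
          simp only [hw]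
          gcongr
          exact (exp_bandRatePrim_sub_le t₀ t).trans (by gcongr)
      _ = 1 / 100 := by norm_num
  have habs := abs_le.1 hw0.symm.le
  have hup := hx.le_of_supersolution (b := fun t => r t + w t)
    (b' := fun t => clippedCubic (r t) t + bandRate t * w t) (t₀ := t₀)
    (fun t _ => (hr t).add (hwd t)) (fun t ht => by
      have hb : r t + w t ∈ band :=
        ⟨by linarith [(hr' t).1, hwnn t], by linarith [(hr' t).2, hwle t ht]⟩
      have hrb := innerBand_subset_band (hr' t)
      rw [clippedCubic_of_mem_band hb, clippedCubic_of_mem_band hrb]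
      have h := rigidCubic_sub (r t + w t) (r t) t
      rw [add_sub_cancel_left] at h
      linarith [mul_le_mul_of_nonneg_right (rigidCubicSlope_le_bandRate hb hrb t) (hwnn t)])
    (by linarith [habs.2]) ht
  have hlow := hx.ge_of_subsolution (a := fun t => r t - w t)
    (a' := fun t => clippedCubic (r t) t - bandRate t * w t) (t₀ := t₀)
    (fun t _ => (hr t).sub (hwd t)) (fun t ht => by
      have hb : r t - w t ∈ band :=
        ⟨by linarith [(hr' t).1, hwle t ht], by linarith [(hr' t).2, hwnn t]⟩
      have hrb := innerBand_subset_band (hr' t)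
      rw [clippedCubic_of_mem_band hb, clippedCubic_of_mem_band hrb]
      have h := rigidCubic_sub (r t) (r t - w t) t
      rw [sub_sub_cancel] at h
      linarith [mul_le_mul_of_nonneg_right (rigidCubicSlope_le_bandRate hrb hb t) (hwnn t)])
    (by linarith [habs.1]) ht
  exact abs_le.2 ⟨by linarith, by linarith⟩

theorem IsClippedSolution.abs_sub_le_two_mul {r x : ℝ → ℝ} (hr : IsClippedSolution r)
    (hr' : ∀ t, r t ∈ innerBand) (hx : IsClippedSolution x) {t₀ : ℝ}
    (h₀ : |x t₀ - r t₀| ≤ 1 / 200) {t : ℝ} (ht : t₀ ≤ t) :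
    |x t - r t| ≤ 2 * |x t₀ - r t₀| * Real.exp (-69 / 1000 * (t - t₀)) := by
  refine (hr.abs_sub_le_exp hr' hx h₀ ht).trans ?_
  rw [mul_comm 2, mul_assoc]
  gcongr
  exact exp_bandRatePrim_sub_le t₀ t

theorem IsClippedSolution.abs_sub_le_two_mul' {r x : ℝ → ℝ} (hr : IsClippedSolution r)
    (hr' : ∀ t, r t ∈ innerBand) (hx : IsClippedSolution x) {t₀ : ℝ}
    (h₀ : |x t₀ - r t₀| ≤ 1 / 200) {t : ℝ} (ht : t₀ ≤ t) :
    |x t - r t| ≤ 2 * |x t₀ - r t₀| := by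
  refine (hr.abs_sub_le_two_mul hr' hx h₀ ht).trans (mul_le_of_le_one_right (by positivity) ?_)
  exact Real.exp_le_one_iff.2 (by nlinarith)

theorem IsClippedSolution.mem_band {r x : ℝ → ℝ} (hr : IsClippedSolution r)
    (hr' : ∀ t, r t ∈ innerBand) (hx : IsClippedSolution x) {t₀ : ℝ}
    (h₀ : |x t₀ - r t₀| ≤ 1 / 200) {t : ℝ} (ht : t₀ ≤ t) : x t ∈ band := by
  have h := abs_le.1 ((hr.abs_sub_le_two_mul' hr' hx h₀ ht).trans
    (mul_le_mul_of_nonneg_left h₀ (by norm_num)))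
  have := hr' t
  constructor <;> linarith [h.1, h.2, this.1, this.2]

theorem IsClippedSolution.isSolutionOn_Ici {r x : ℝ → ℝ} (hr : IsClippedSolution r)
    (hr' : ∀ t, r t ∈ innerBand) (hx : IsClippedSolution x) {t₀ : ℝ}
    (h₀ : |x t₀ - r t₀| ≤ 1 / 200) : IsSolutionOn rigidCubic (Ici t₀) x := fun _ ht =>
  (hx.hasDerivAt_rigidCubic (hr.mem_band hr' hx h₀ ht)).hasDerivWithinAt

theorem IsSolutionOn.mono {X : ℝ → ℝ → ℝ} {s s' : Set ℝ} {x : ℝ → ℝ} (hx : IsSolutionOn X s x)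
    (h : s' ⊆ s) : IsSolutionOn X s' x := fun t ht => (hx t (h ht)).mono h

/-- Uniqueness for the original equation, whose right-hand side is only locally Lipschitz:
solutions on a compact interval are bounded. -/
theorem IsSolutionOn.eqOn_Icc {x y : ℝ → ℝ} {a b : ℝ} (hx : IsSolutionOn rigidCubic (Icc a b) x)
    (hy : IsSolutionOn rigidCubic (Icc a b) y) (h : x a = y a) : EqOn x y (Icc a b) := by
  have hxc : ContinuousOn x (Icc a b) := fun t ht => (hx t ht).continuousWithinAt
  have hyc : ContinuousOn y (Icc a b) := fun t ht => (hy t ht).continuousWithinAt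
  obtain ⟨Cx, hCx⟩ := isCompact_Icc.exists_bound_of_continuousOn hxc
  obtain ⟨Cy, hCy⟩ := isCompact_Icc.exists_bound_of_continuousOn hyc
  set R := max Cx Cy
  -- away from `b`, derivatives within `Icc a b` are right derivatives
  have hright : ∀ {z : ℝ → ℝ}, IsSolutionOn rigidCubic (Icc a b) z →
      ∀ t ∈ Ico a b, HasDerivWithinAt z (rigidCubic (z t) t) (Ici t) t := fun hz t ht =>
    (hz t (Ico_subset_Icc_self ht)).mono_of_mem_nhdsWithin
      (mem_of_superset (Icc_mem_nhdsGE ht.2) (Icc_subset_Icc_left ht.1))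
  refine ODE_solution_unique_of_mem_Icc_right (v := fun t x => rigidCubic x t)
    (s := fun _ => {z | |z| ≤ R}) (K := (1 / 10 + R / 5 + 3 * R ^ 2).toNNReal)
    (fun t _ => LipschitzOnWith.of_dist_le' fun p hp q hq => ?_) hxc (hright hx)
    (fun t ht => (hCx t (Ico_subset_Icc_self ht)).trans (le_max_left _ _)) hyc (hright hy)
    (fun t ht => (hCy t (Ico_subset_Icc_self ht)).trans (le_max_right _ _)) h
  rw [Real.dist_eq, Real.dist_eq, rigidCubic_sub, abs_mul]
  exact mul_le_mul_of_nonneg_right (abs_rigidCubicSlope_le hp hq t) (abs_nonneg _)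

theorem IsSolutionOn.eqOn_Ici {x y : ℝ → ℝ} {a : ℝ} (hx : IsSolutionOn rigidCubic (Ici a) x)
    (hy : IsSolutionOn rigidCubic (Ici a) y) (h : x a = y a) : EqOn x y (Ici a) := fun _ ht =>
  (hx.mono Icc_subset_Ici_self).eqOn_Icc (hy.mono Icc_subset_Ici_self) h (right_mem_Icc.2 ht)

theorem continuous_rigidCubicSlope {x y : ℝ → ℝ} (hx : Continuous x) (hy : Continuous y) :
    Continuous fun t => rigidCubicSlope (x t) (y t) t := by
  unfold rigidCubicSlope
  fun_prop

/-- The difference `d` of two solutions satisfies the linear equation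
`d' = rigidCubicSlope x y t * d`. -/
theorem IsClippedSolution.sub_eq_mul_exp {x y : ℝ → ℝ} (hx : IsClippedSolution x)
    (hy : IsClippedSolution y) {a b : ℝ} (hxb : ∀ t ∈ Icc a b, x t ∈ band)
    (hyb : ∀ t ∈ Icc a b, y t ∈ band) (hab : a ≤ b) :
    x b - y b = (x a - y a) * Real.exp (∫ t in a..b, rigidCubicSlope (x t) (y t) t) := by
  have hc := continuous_rigidCubicSlope hx.continuous hy.continuous
  set I : ℝ → ℝ := fun s => ∫ t in a..s, rigidCubicSlope (x t) (y t) t with hI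
  have hId : ∀ s, HasDerivAt I (rigidCubicSlope (x s) (y s) s) s := fun s =>
    hc.integral_hasStrictDerivAt a s |>.hasDerivAt
  have hd : ∀ t ∈ Icc a b, HasDerivAt (fun t => (x t - y t) * Real.exp (-I t)) 0 t := by
    intro t ht
    refine (((hx.hasDerivAt_rigidCubic (hxb t ht)).sub
      (hy.hasDerivAt_rigidCubic (hyb t ht))).mul (hId t).neg.exp).congr_deriv ?_
    rw [Pi.sub_apply, Pi.neg_apply, rigidCubic_sub]
    ring
  have h := constant_of_has_deriv_right_zero
    (fun t ht => (hd t ht).continuousAt.continuousWithinAt)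
    (fun t ht => (hd t (Ico_subset_Icc_self ht)).hasDerivWithinAt) b (right_mem_Icc.2 hab)
  have hIa : I a = 0 := by simp [hI]
  rw [hIa, neg_zero, Real.exp_zero, mul_one] at h
  rw [← h, mul_assoc, ← Real.exp_add, neg_add_cancel, Real.exp_zero, mul_one]

/-! ### Hyperbolicity, stability and uniqueness -/

/-- Along a solution in the band the linearization is negative on average. -/
theorem integral_rigidCubicSlope_diag_neg {r : ℝ → ℝ} (hr : Continuous r) (hr' : ∀ t, r t ∈ band) :
    ∫ t in (0 : ℝ)..2 * Real.pi, rigidCubicSlope (r t) (r t) t < 0 := by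
  have hc : Continuous bandRate := by unfold bandRate; fun_prop
  have hint : ∫ t in (0 : ℝ)..2 * Real.pi, bandRate t = -69 / 1000 * (2 * Real.pi) := by
    rw [intervalIntegral.integral_eq_sub_of_hasDerivAt (fun t _ => hasDerivAt_bandRatePrim t)
      (hc.intervalIntegrable _ _)]
    have h : Real.sin (2 * (2 * Real.pi)) = 0 := by rw [Real.sin_two_mul, Real.sin_two_pi]; simp
    simp [bandRatePrim, h]
  calc ∫ t in (0 : ℝ)..2 * Real.pi, rigidCubicSlope (r t) (r t) t
      ≤ ∫ t in (0 : ℝ)..2 * Real.pi, bandRate t :=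
        intervalIntegral.integral_mono_on (by positivity)
          ((continuous_rigidCubicSlope hr hr).intervalIntegrable _ _)
          (hc.intervalIntegrable _ _)
          fun t _ => rigidCubicSlope_le_bandRate (hr' t) (hr' t) t
    _ < 0 := by
        rw [hint]
        linarith [Real.pi_pos]

/-- The difference quotient of the return map between `ξ` and `r 0` is
`exp (∫ rigidCubicSlope x r)`, where `x` is the solution with initial value `ξ`; as `ξ → r 0`,
`x` tends to `r` uniformly and the integrand to `∂X/∂x` along `r`. -/
theorem IsClippedSolution.isHyperbolic {r : ℝ → ℝ} (hr : IsClippedSolution r)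
    (hr' : ∀ t, r t ∈ innerBand) : IsHyperbolic rigidCubic (2 * Real.pi) r := by
  choose Φ hΦ0 hΦ using exists_isClippedSolution 0
  have hpi : (0 : ℝ) ≤ 2 * Real.pi := by positivity
  have hrb : ∀ t, r t ∈ band := fun t => innerBand_subset_band (hr' t)
  have hnear : ∀ᶠ ξ in 𝓝 (r 0), |ξ - r 0| ≤ 1 / 200 := by
    filter_upwards [Metric.closedBall_mem_nhds (r 0) (show (0 : ℝ) < 1 / 200 by norm_num)] with ξ hξ
    simpa [Real.dist_eq] using hξ
  set J : ℝ → ℝ := fun ξ =>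
    ∫ t in (0 : ℝ)..2 * Real.pi, rigidCubicSlope (Φ ξ t) (r t) t with hJ
  set I : ℝ := ∫ t in (0 : ℝ)..2 * Real.pi, rigidCubicSlope (r t) (r t) t with hI
  refine ⟨fun ξ => Φ ξ (2 * Real.pi), Real.exp I, ?_, ?_, ?_⟩
  · filter_upwards [hnear] with ξ hξ
    have hsol := (hr.isSolutionOn_Ici hr' (hΦ ξ) (t₀ := 0) (by rwa [hΦ0])).mono
      (Icc_subset_Ici_self : Icc 0 (2 * Real.pi) ⊆ Ici 0)
    exact ⟨⟨Φ ξ, hsol, hΦ0 ξ⟩, fun x hx hx0 =>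
      hx.eqOn_Icc hsol (hx0.trans (hΦ0 ξ).symm) (right_mem_Icc.2 hpi)⟩
  · have hbound : ∀ᶠ ξ in 𝓝 (r 0), |J ξ - I| ≤ 4 * |ξ - r 0| * |2 * Real.pi - 0| := by
      filter_upwards [hnear] with ξ hξ
      have hξ' : |Φ ξ 0 - r 0| ≤ 1 / 200 := by rwa [hΦ0]
      rw [hJ, hI, ← intervalIntegral.integral_sub
        ((continuous_rigidCubicSlope (hΦ ξ).continuous hr.continuous).intervalIntegrable _ _)
        ((continuous_rigidCubicSlope hr.continuous hr.continuous).intervalIntegrable _ _)]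
      refine intervalIntegral.norm_integral_le_of_norm_le_const (E := ℝ) fun t ht => ?_
      rw [uIoc_of_le hpi] at ht
      have h1 := abs_rigidCubicSlope_sub_diag_le (hr.mem_band hr' (hΦ ξ) hξ' ht.1.le) (hrb t) t
      have h2 := hr.abs_sub_le_two_mul' hr' (hΦ ξ) hξ' ht.1.le
      rw [hΦ0] at h2
      rw [Real.norm_eq_abs]
      linarith
    have hJI : Tendsto J (𝓝 (r 0)) (𝓝 I) := by
      rw [tendsto_iff_norm_sub_tendsto_zero]
      refine squeeze_zero' (Eventually.of_forall fun _ => norm_nonneg _) hbound ?_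
      have hc : Continuous fun ξ => 4 * |ξ - r 0| * |2 * Real.pi - 0| := by fun_prop
      simpa using hc.tendsto (r 0)
    rw [hasDerivAt_iff_tendsto_slope]
    refine (((Real.continuous_exp.tendsto I).comp hJI).mono_left nhdsWithin_le_nhds).congr' ?_
    filter_upwards [hnear.filter_mono nhdsWithin_le_nhds, self_mem_nhdsWithin] with ξ hξ hne
    have hne : ξ - r 0 ≠ 0 := sub_ne_zero.2 hne
    have hξ' : |Φ ξ 0 - r 0| ≤ 1 / 200 := by rwa [hΦ0]
    have hr0 : Φ (r 0) = r := (hΦ (r 0)).ext hr (hΦ0 (r 0))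
    have h := (hΦ ξ).sub_eq_mul_exp hr (fun t ht => hr.mem_band hr' (hΦ ξ) hξ' ht.1)
      (fun t _ => hrb t) hpi
    rw [hΦ0] at h
    rw [slope_def_field, hr0, h]
    simp only [Function.comp, hJ]
    field_simp
  · have hneg : I < 0 := integral_rigidCubicSlope_diag_neg hr.continuous hrb
    rw [abs_of_pos (Real.exp_pos I)]
    exact (Real.exp_lt_one_iff.2 hneg).ne

theorem IsClippedSolution.isLyapunovStable {r : ℝ → ℝ} (hr : IsClippedSolution r)
    (hr' : ∀ t, r t ∈ innerBand) : IsLyapunovStable rigidCubic r := by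
  intro t₀ ε hε
  refine ⟨min (1 / 200) (ε / 2), by positivity, fun ξ hξ => ?_⟩
  obtain ⟨y, hy0, hy⟩ := exists_isClippedSolution t₀ ξ
  have hξ' : |y t₀ - r t₀| ≤ 1 / 200 := by
    rw [hy0]
    exact hξ.le.trans (min_le_left _ _)
  have hsol := hr.isSolutionOn_Ici hr' hy hξ'
  refine ⟨⟨y, hsol, hy0⟩, fun x hx hx0 t ht => ?_⟩
  rw [hx.eqOn_Ici hsol (hx0.trans hy0.symm) ht]
  have h := hr.abs_sub_le_two_mul' hr' hy hξ' ht
  rw [hy0] at h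
  linarith [hξ.trans_le (min_le_right _ _)]

theorem tendsto_two_mul_exp_rate (C t₀ : ℝ) :
    Tendsto (fun t => 2 * C * Real.exp (-69 / 1000 * (t - t₀))) atTop (𝓝 0) := by
  have h : Tendsto (fun t : ℝ => -69 / 1000 * (t - t₀)) atTop atBot :=
    (tendsto_atTop_add_const_right _ (-t₀) tendsto_id).const_mul_atTop_of_neg (by norm_num)
  simpa using (Real.tendsto_exp_atBot.comp h).const_mul (2 * C)

theorem IsClippedSolution.isAsymptoticallyStable {r : ℝ → ℝ} (hr : IsClippedSolution r)
    (hr' : ∀ t, r t ∈ innerBand) : IsAsymptoticallyStable rigidCubic r := by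
  refine ⟨hr.isLyapunovStable hr', fun t₀ => ⟨1 / 200, by norm_num, fun x hx hx0 => ?_⟩⟩
  obtain ⟨y, hy0, hy⟩ := exists_isClippedSolution t₀ (x t₀)
  have hy' : |y t₀ - r t₀| ≤ 1 / 200 := by rw [hy0]; exact hx0.le
  have hsol := hr.isSolutionOn_Ici hr' hy hy'
  refine squeeze_zero_norm' ?_ (tendsto_two_mul_exp_rate |y t₀ - r t₀| t₀)
  filter_upwards [eventually_ge_atTop t₀] with t ht
  rw [hx.eqOn_Ici hsol hy0.symm ht]
  exact hr.abs_sub_le_two_mul hr' hy hy' ht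

/-- Two solutions that stay in the band for all time, past and future, coincide: their distance is
bounded, and it contracts exponentially from the remote past to the present. -/
theorem le_of_solutions_in_band {x y : ℝ → ℝ} (hx : ∀ t, HasDerivAt x (rigidCubic (x t) t) t)
    (hy : ∀ t, HasDerivAt y (rigidCubic (y t) t) t) (hxb : ∀ t, x t ∈ band)
    (hyb : ∀ t, y t ∈ band) (t : ℝ) : x t ≤ y t := by
  have hbound : ∀ s ≤ t, x t - y t ≤ 2 * 1 * Real.exp (-69 / 1000 * (t - s)) := fun s hs => by
    have h := le_max_mul_exp_of_deriv_le (u := fun t => x t - y t) (a := s)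
      (fun t _ => (hx t).sub (hy t)) hasDerivAt_bandRatePrim (fun t _ hpos => by
        rw [rigidCubic_sub]
        exact mul_le_mul_of_nonneg_right (rigidCubicSlope_le_bandRate (hxb t) (hyb t) t) hpos.le) hs
    have h1 : max (x s - y s) 0 ≤ 1 :=
      max_le (by linarith [(hxb s).2, (hyb s).1]) zero_le_one
    calc x t - y t ≤ max (x s - y s) 0 * Real.exp (bandRatePrim t - bandRatePrim s) := h
      _ ≤ 1 * (2 * Real.exp (-69 / 1000 * (t - s))) := by
          gcongr
          exact exp_bandRatePrim_sub_le s t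
      _ = _ := by ring
  have hlim : Tendsto (fun s => 2 * 1 * Real.exp (-69 / 1000 * (t - s))) atBot (𝓝 0) := by
    have h := (tendsto_two_mul_exp_rate 1 (-t)).comp tendsto_neg_atBot_atTop
    refine h.congr fun s => ?_
    simp only [Function.comp]
    ring_nf
  exact sub_nonpos.1 (ge_of_tendsto hlim ((eventually_le_atBot t).mono hbound))

theorem proposition2 :
    ∃ r : ℝ → ℝ,
      IsPeriodicSolution rigidCubic (2 * Real.pi) r ∧
      InStrip rBar 0.042 r ∧
      IsNoncritical rigidCubic (2 * Real.pi) r ∧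
      IsHyperbolic rigidCubic (2 * Real.pi) r ∧
      IsAsymptoticallyStable rigidCubic r ∧
      ∀ (T : ℝ) (ρ : ℝ → ℝ),
        IsPeriodicSolution rigidCubic T ρ → InStrip rBar 0.042 ρ → ρ = r := by
  obtain ⟨r, hr, hper, hbar⟩ := exists_periodic_isClippedSolution
  have hr' : ∀ t, r t ∈ innerBand := fun t =>
    ⟨(lowerBarrier_mem t).1.trans (hbar t).1, (hbar t).2.trans (upperBarrier_mem t).2⟩
  have hrb : ∀ t, r t ∈ band := fun t => innerBand_subset_band (hr' t)
  have hrd : ∀ t, HasDerivAt r (rigidCubic (r t) t) t := fun t => hr.hasDerivAt_rigidCubic (hrb t)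
  refine ⟨r, ⟨by positivity, hper, fun t _ => (hrd t).hasDerivWithinAt⟩, fun t => abs_le.2 ⟨?_, ?_⟩,
    ?_, hr.isHyperbolic hr', hr.isAsymptoticallyStable hr', fun T ρ hρ hstrip => ?_⟩
  · linarith [upperBarrier_le_rBar_add t, (hbar t).2]
  · linarith [rBar_sub_le_lowerBarrier t, (hbar t).1]
  · simp only [IsNoncritical, deriv_rigidCubic]
    exact (integral_rigidCubicSlope_diag_neg hr.continuous hrb).ne
  · have hρd : ∀ t, HasDerivAt ρ (rigidCubic (ρ t) t) t := fun t =>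
      hasDerivWithinAt_univ.1 (hρ.2.2 t (mem_univ t))
    have hρb : ∀ t, ρ t ∈ band := fun t => mem_band_of_abs_rBar_sub_le (hstrip t)
    exact funext fun t => le_antisymm (le_of_solutions_in_band hρd hrd hρb hrb t)
      (le_of_solutions_in_band hrd hρd hrb hρb t)
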